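/- All groups are abelian, $\mathrm{Ext}$ denotes $\mathrm{Ext}^1_{\mathbb Z}$, and a group $A$ is called a \emph{Whitehead group} if $\mathrm{Ext}(A,\mathbb Z)=0$. Assume GCH, i.e. $2^{\kappa}=\kappa^{+}$ for every infinite cardinal $\kappa$. Suppose that for every Whitehead group $A$ of infinite rank there is a Whitehead group $H_A$ of cardinality at most $|A|^{+}$ such that $\mathrm{Ext}(H_A,A)\neq 0$. Then for every Whitehead group $B$ there is an uncountable Whitehead group $G$ such that every homomorphism from $G$ to $B$ has finitely generated range. -/

import Mathlib

open Cardinal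

universe u

/-- The generalized continuum hypothesis: `2 ^ κ = κ⁺` for every infinite cardinal `κ`. -/
def GCH : Prop := ∀ κ : Cardinal.{u}, ℵ₀ ≤ κ → 2 ^ κ = Order.succ κ

/-- The group `Ext(A, C) = Ext¹_ℤ(A, C)` of two abelian groups. -/
abbrev ExtGroup (A C : Type u) [AddCommGroup A] [AddCommGroup C] : Type u :=
  CategoryTheory.Abelian.Ext.{u} (ModuleCat.of ℤ A) (ModuleCat.of ℤ C) 1

/-- An abelian group `A` is a Whitehead group if `Ext(A, ℤ) = 0`. The integers are lifted to the
universe of `A`. -/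
def IsWhitehead (A : Type u) [AddCommGroup A] : Prop :=
  Subsingleton (ExtGroup A (ULift.{u} ℤ))

open CategoryTheory Abelian Limits

/-! As `ℝ` is injective, `A` is Whitehead iff every character `A → ℝ/ℤ` lifts to `ℝ`, that is, iff
`0 → A` lifts against `ℝ → ℝ/ℤ`. Maps with this lifting property are stable under coproducts,
pushouts and transfinite composition, so they build Whitehead groups from a free one. A map `h : X →
B` whose range `A` is not finitely generated is killed as follows. `A` is Whitehead, of infinite
rank by `CharactersLift.finite_of_rank_lt_aleph0`, so for some Whitehead `H = F/K` with `F` free, a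
map `K → A` does not extend to `F`. It lifts to `K → X`, and `h` does not extend to the pushout of
`X` along `K → F` with values in `A`. `exists_killing_extension` treats all `h` at once. After
iterating along a regular cardinal above `|B|`, the range of any `f : G → B` is attained at some
stage, and the next stage forces it to be finitely generated. -/

/-- Vanishing of `Ext¹(X, S.X₁)` for an injective `S.X₂` is the lifting of maps to `S.X₃`. -/
lemma ext_subsingleton_iff_lifts {C : Type*} [Category* C] [Abelian C] [HasExt.{u} C]
    {S : ShortComplex C} (hS : S.ShortExact) [Injective S.X₂] (X : C) :
    Subsingleton (Ext.{u} X S.X₁ 1) ↔ ∀ f : X ⟶ S.X₃, ∃ g : X ⟶ S.X₂, g ≫ S.g = f := by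
  constructor
  · intro h f
    obtain ⟨x, hx⟩ := Ext.covariant_sequence_exact₃ X hS (Ext.mk₀ f) (zero_add 1)
      (Subsingleton.elim _ _)
    obtain ⟨g, rfl⟩ := (Ext.mk₀_bijective _ _).2 x
    refine ⟨g, (Ext.mk₀_bijective _ _).1 ?_⟩
    simpa using hx
  · intro h
    refine subsingleton_of_forall_eq 0 fun x => ?_
    obtain ⟨y, rfl⟩ := Ext.covariant_sequence_exact₁ X hS x (Ext.eq_zero_of_injective _)
      (zero_add 1)
    obtain ⟨f, rfl⟩ := (Ext.mk₀_bijective _ _).2 y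
    obtain ⟨g, rfl⟩ := h f
    rw [← Ext.mk₀_comp_mk₀, Ext.comp_assoc_of_second_deg_zero]
    simp

/-- If `S.X₂` is projective and every map `S.X₁ ⟶ Y` extends to `S.X₂`, then `Ext¹(S.X₃, Y) = 0`. -/
lemma ext_subsingleton_of_extends {C : Type*} [Category* C] [Abelian C] [HasExt.{u} C]
    {S : ShortComplex C} (hS : S.ShortExact) [Projective S.X₂] (Y : C)
    (h : ∀ k : S.X₁ ⟶ Y, ∃ g : S.X₂ ⟶ Y, S.f ≫ g = k) :
    Subsingleton (Ext.{u} S.X₃ Y 1) := by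
  refine subsingleton_of_forall_eq 0 fun x => ?_
  obtain ⟨y, rfl⟩ := Ext.contravariant_sequence_exact₃ hS Y x
    (Ext.eq_zero_of_projective _) (add_zero 1)
  obtain ⟨f, rfl⟩ := (Ext.mk₀_bijective _ _).2 y
  obtain ⟨g, rfl⟩ := h f
  rw [← Ext.mk₀_comp_mk₀, hS.extClass_comp_assoc]

/-! ### Whitehead groups through lifting of characters -/

/-- Every character of `A` lifts to a homomorphism to the reals. -/
def CharactersLift (A : Type*) [AddCommGroup A] : Prop :=
  ∀ χ : A →+ UnitAddCircle, ∃ g : A →+ ℝ, ∀ a, (g a : UnitAddCircle) = χ a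

/-- The projection `ℝ → ℝ / ℤ`, lifted to the universe `u`. -/
noncomputable def realToCircle :
    ModuleCat.of ℤ (ULift.{u} ℝ) ⟶ ModuleCat.of ℤ (ULift.{u} UnitAddCircle) :=
  ModuleCat.ofHom <| AddMonoidHom.toIntLinearMap <|
    (AddEquiv.ulift.symm.toAddMonoidHom.comp
      (QuotientAddGroup.mk' (AddSubgroup.zmultiples (1 : ℝ)))).comp AddEquiv.ulift.toAddMonoidHom

lemma realToCircle_apply (x : ULift.{u} ℝ) :
    realToCircle.{u} x = ULift.up (x.down : UnitAddCircle) := rfl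

/-- The inclusion `ℤ → ℝ`, lifted to the universe `u`. -/
noncomputable def intToReal :
    ModuleCat.of ℤ (ULift.{u} ℤ) ⟶ ModuleCat.of ℤ (ULift.{u} ℝ) :=
  ModuleCat.ofHom <| AddMonoidHom.toIntLinearMap <|
    (AddEquiv.ulift.symm.toAddMonoidHom.comp
      (Int.castAddHom ℝ)).comp AddEquiv.ulift.toAddMonoidHom

lemma coe_eq_zero_iff_exists_int (x : ℝ) : (x : UnitAddCircle) = 0 ↔ ∃ n : ℤ, (n : ℝ) = x := by
  rw [AddCircle.coe_eq_zero_iff]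
  simp

lemma intToReal_comp_realToCircle : intToReal.{u} ≫ realToCircle.{u} = 0 := by
  refine ModuleCat.hom_ext (LinearMap.ext fun x => ULift.down_injective ?_)
  exact (coe_eq_zero_iff_exists_int _).2 ⟨x.down, rfl⟩

lemma intToReal_shortExact :
    (ShortComplex.mk _ _ intToReal_comp_realToCircle.{u}).ShortExact where
  exact := by
    rw [ShortComplex.moduleCat_exact_iff]
    intro x hx
    change realToCircle x = 0 at hx
    rw [realToCircle_apply] at hx
    obtain ⟨n, hn⟩ := (coe_eq_zero_iff_exists_int _).1 (congrArg ULift.down hx)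
    exact ⟨ULift.up n, ULift.down_injective hn⟩
  mono_f := by
    rw [ModuleCat.mono_iff_injective]
    intro x y hxy
    have h : ULift.up ((x.down : ℝ)) = ULift.up ((y.down : ℝ)) := hxy
    exact ULift.down_injective (Int.cast_injective (congrArg ULift.down h))
  epi_g := by
    rw [ModuleCat.epi_iff_surjective]
    rintro ⟨y⟩
    obtain ⟨x, rfl⟩ := QuotientAddGroup.mk_surjective y
    exact ⟨ULift.up x, rfl⟩

lemma real_baer : Module.Baer ℤ ℝ := Module.Baer.of_divisible ℝ

instance injective_ulift_real : Injective (ModuleCat.of ℤ (ULift.{u} ℝ)) := by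
  have : Module.Baer ℤ (ULift.{u} ℝ) := Module.Baer.of_equiv ULift.moduleEquiv.symm real_baer
  have := this.injective
  exact Module.injective_object_of_injective_module ..

/-- Additive maps are morphisms of the category of `ℤ`-modules. -/
def moduleHomOfAdd {X Y : ModuleCat.{u} ℤ} (f : X →+ Y) : X ⟶ Y :=
  ModuleCat.ofHom { f with map_smul' := fun n x => by simpa using map_intCast_smul f ℤ ℤ n x }

/-- Homomorphisms into a lifted group as morphisms of the category of `ℤ`-modules. -/
def homToULift {X : ModuleCat.{u} ℤ} {D : Type} [AddCommGroup D] (f : X →+ D) :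
    X ⟶ ModuleCat.of ℤ (ULift.{u} D) :=
  moduleHomOfAdd (Y := ModuleCat.of ℤ (ULift.{u} D)) (AddEquiv.ulift.symm.toAddMonoidHom.comp f)

/-- The homomorphism underlying a morphism into a lifted group. -/
def homOfULift {X : ModuleCat.{u} ℤ} {D : Type} [AddCommGroup D]
    (f : X ⟶ ModuleCat.of ℤ (ULift.{u} D)) : X →+ D :=
  AddEquiv.ulift.toAddMonoidHom.comp f.hom.toAddMonoidHom

/-- `0 → ℤ → ℝ → ℝ/ℤ → 0` with `ℝ` injective makes `Ext(A, ℤ)` the cokernel of `Hom(A, ℝ) → Hom(A,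
ℝ/ℤ)`. -/
theorem isWhitehead_iff_charactersLift (A : Type u) [AddCommGroup A] :
    IsWhitehead A ↔ CharactersLift A := by
  have : Injective (ShortComplex.mk _ _ intToReal_comp_realToCircle.{u}).X₂ :=
    injective_ulift_real
  refine (ext_subsingleton_iff_lifts intToReal_shortExact.{u} (ModuleCat.of ℤ A)).trans ?_
  constructor
  · intro h χ
    obtain ⟨g, hg⟩ := h (homToULift (X := ModuleCat.of ℤ A) χ)
    refine ⟨homOfULift g, fun a => ?_⟩
    exact congrArg ULift.down (congrArg (fun φ => φ.hom a) hg)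
  · intro h f
    obtain ⟨g, hg⟩ := h (homOfULift f)
    refine ⟨homToULift (X := ModuleCat.of ℤ A) g, ?_⟩
    refine ModuleCat.hom_ext (LinearMap.ext fun a => ?_)
    exact ULift.down_injective (hg a)

theorem hasLiftingProperty_realToCircle_iff {X Y : ModuleCat.{u} ℤ} (i : X ⟶ Y) :
    HasLiftingProperty i realToCircle.{u} ↔
      ∀ (v : X →+ ℝ) (χ : Y →+ UnitAddCircle), (∀ x, (v x : UnitAddCircle) = χ (i x)) →
        ∃ g : Y →+ ℝ, (∀ x, g (i x) = v x) ∧ ∀ y, (g y : UnitAddCircle) = χ y := by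
  constructor
  · intro h v χ hv
    have sq : CommSq (homToULift v) i realToCircle (homToULift χ) :=
      ⟨ModuleCat.hom_ext (LinearMap.ext fun x => ULift.down_injective (hv x))⟩
    refine ⟨homOfULift sq.lift, fun x => ?_, fun y => ?_⟩
    · exact congrArg ULift.down (congrArg (fun φ => φ.hom x) sq.fac_left)
    · exact congrArg ULift.down (congrArg (fun φ => φ.hom y) sq.fac_right)
  · refine fun h => ⟨fun {f g} sq => ?_⟩
    obtain ⟨l, hl, hl'⟩ := h (homOfULift f) (homOfULift g) fun x =>
      congrArg ULift.down (congrArg (fun φ => φ.hom x) sq.w)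
    refine ⟨⟨⟨homToULift l, ?_, ?_⟩⟩⟩
    · exact ModuleCat.hom_ext (LinearMap.ext fun x => ULift.down_injective (hl x))
    · exact ModuleCat.hom_ext (LinearMap.ext fun y => ULift.down_injective (hl' y))

/-- The lifting of characters passes along maps with the lifting property against `ℝ → ℝ / ℤ`. -/
lemma CharactersLift.of_hasLiftingProperty {X Y : ModuleCat.{u} ℤ} (i : X ⟶ Y)
    (hi : HasLiftingProperty i realToCircle.{u}) (hX : CharactersLift X) : CharactersLift Y := by
  intro χ
  obtain ⟨v, hv⟩ := hX (χ.comp i.hom.toAddMonoidHom)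
  obtain ⟨g, -, hg⟩ := (hasLiftingProperty_realToCircle_iff i).1 hi v χ hv
  exact ⟨g, hg⟩

/-- An injection with Whitehead cokernel has the lifting property against `ℝ → ℝ / ℤ`. -/
lemma hasLiftingProperty_of_exact {S : ShortComplex (ModuleCat.{u} ℤ)} (hS : S.ShortExact)
    (h : CharactersLift S.X₃) : HasLiftingProperty S.f realToCircle.{u} := by
  rw [hasLiftingProperty_realToCircle_iff]
  intro v χ hv
  have hinj : Function.Injective S.f := (ModuleCat.mono_iff_injective _).1 hS.mono_f
  have hsurj : Function.Surjective S.g := (ModuleCat.epi_iff_surjective _).1 hS.epi_g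
  obtain ⟨w, hw⟩ := real_baer.extension_property_addMonoidHom S.f.hom.toAddMonoidHom hinj v
  -- The error `d` of the extension `w` vanishes on `S.X₁`, so it is a character of `S.X₃`; its lift
  -- corrects `w`.
  let d : S.X₂ →+ UnitAddCircle :=
    χ - (QuotientAddGroup.mk' (AddSubgroup.zmultiples (1 : ℝ))).comp w
  have hwx (x) : w (S.f x) = v x := DFunLike.congr_fun hw x
  have hd : S.g.hom.toAddMonoidHom.ker ≤ d.ker := by
    intro y hy
    obtain ⟨x, rfl⟩ := (ShortComplex.moduleCat_exact_iff S).1 hS.exact y hy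
    change χ (S.f x) - ((w (S.f x) : ℝ) : UnitAddCircle) = 0
    rw [hwx, hv, sub_self]
  obtain ⟨g, hg⟩ := h (S.g.hom.toAddMonoidHom.liftOfSurjective hsurj ⟨d, hd⟩)
  have hg' (y) : (g (S.g y) : UnitAddCircle) = d y := by
    rw [hg]
    exact AddMonoidHom.liftOfRightInverse_comp_apply _ _ _ ⟨d, hd⟩ y
  refine ⟨w + g.comp S.g.hom.toAddMonoidHom, fun x => ?_, fun y => ?_⟩
  · have : S.g (S.f x) = 0 := congrArg (fun φ => φ.hom x) S.zero
    change w (S.f x) + g (S.g (S.f x)) = v x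
    rw [this, hwx]; simp
  · change ((w y + g (S.g y) : ℝ) : UnitAddCircle) = χ y
    rw [AddCircle.coe_add, hg']
    exact add_sub_cancel _ _

lemma CharactersLift.of_injective {A B : Type*} [AddCommGroup A] [AddCommGroup B] (f : A →+ B)
    (hf : Function.Injective f) (hB : CharactersLift B) : CharactersLift A := by
  intro χ
  obtain ⟨ψ, hψ⟩ := (Module.Baer.of_divisible UnitAddCircle).extension_property_addMonoidHom f hf χ
  obtain ⟨g, hg⟩ := hB ψ
  exact ⟨g.comp f, fun a => (hg (f a)).trans (DFunLike.congr_fun hψ a)⟩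

/-! ### Whitehead groups of finite rank -/

/-- Characters with values in `ℝ / ℤ` separate points from subgroups. -/
lemma exists_character_ne_zero {A : Type*} [AddCommGroup A] (F : AddSubgroup A) {x : A}
    (hx : x ∉ F) : ∃ χ : A →+ UnitAddCircle, (∀ y ∈ F, χ y = 0) ∧ χ x ≠ 0 := by
  have hx' : (QuotientAddGroup.mk x : A ⧸ F) ≠ 0 := by
    rwa [Ne, QuotientAddGroup.eq_zero_iff]
  obtain ⟨c, hc⟩ := CharacterModule.exists_character_apply_ne_zero_of_ne_zero hx'
  -- `c` takes values in `ℚ/ℤ`, which embeds in `ℝ/ℤ`.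
  let ι : AddCircle (1 : ℚ) →+ UnitAddCircle :=
    QuotientAddGroup.map (AddSubgroup.zmultiples (1 : ℚ)) (AddSubgroup.zmultiples (1 : ℝ))
      (Rat.castHom ℝ).toAddMonoidHom (by
        rw [AddSubgroup.zmultiples_le]
        exact AddSubgroup.mem_comap.2 (by simp))
  have hι : Function.Injective ι := by
    rw [injective_iff_map_eq_zero]
    intro q hq
    obtain ⟨r, rfl⟩ := QuotientAddGroup.mk_surjective q
    have hq' : ((r : ℝ) : UnitAddCircle) = 0 := hq
    obtain ⟨n, hn⟩ := (coe_eq_zero_iff_exists_int _).1 hq'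
    rw [QuotientAddGroup.eq_zero_iff, AddSubgroup.mem_zmultiples_iff]
    exact ⟨n, by rw [zsmul_one]; exact_mod_cast hn⟩
  refine ⟨(ι.comp c).comp (QuotientAddGroup.mk' F), fun y hy => ?_, fun h => hc (hι ?_)⟩
  · have : QuotientAddGroup.mk' F y = 0 := (QuotientAddGroup.eq_zero_iff y).2 hy
    simp only [AddMonoidHom.comp_apply, this, map_zero]
  · rw [map_zero]; exact h

/-- Homomorphisms to `ℝ` kill torsion, so a character nonzero at a torsion element cannot lift. -/
lemma CharactersLift.eq_zero_of_zsmul_eq_zero {A : Type*} [AddCommGroup A] (h : CharactersLift A)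
    {n : ℤ} (hn : n ≠ 0) {x : A} (hx : n • x = 0) : x = 0 := by
  by_contra hx0
  obtain ⟨χ, -, hχ⟩ := exists_character_ne_zero (⊥ : AddSubgroup A) (x := x) (by simpa using hx0)
  obtain ⟨g, hg⟩ := h χ
  apply hχ
  have : n • g x = 0 := by rw [← map_zsmul, hx, map_zero]
  rw [← hg, (smul_eq_zero.1 this).resolve_left hn]
  rfl

/-- A countable compact Hausdorff topological group is finite. -/
lemma finite_of_countable_of_compact (S : Type*) [AddGroup S] [TopologicalSpace S]
    [IsTopologicalAddGroup S] [CompactSpace S] [T2Space S] [Countable S] : Finite S := by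
  -- By Baire, some point is open; by translation the group is discrete.
  obtain ⟨s, hs⟩ := nonempty_interior_of_iUnion_of_closed (f := fun s : S => ({s} : Set S))
    (fun s => isClosed_singleton) (Set.eq_univ_of_forall fun s => Set.mem_iUnion.2 ⟨s, rfl⟩)
  have hopen : IsOpen ({s} : Set S) := by
    rw [← Set.Nonempty.subset_singleton_iff hs |>.1 interior_subset]
    exact isOpen_interior
  have h0 : IsOpen ({0} : Set S) := by
    have := hopen.preimage (continuous_const_add s)
    convert this using 1
    ext t
    simp
  have := discreteTopology_of_isOpen_singleton_zero h0
  exact finite_of_compact_of_discrete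

/-- The group of characters vanishing on `F`, inside the compact group of all functions. -/
def characterAnnihilator {A : Type*} [AddCommGroup A] (F : Set A) :
    AddSubgroup (A → UnitAddCircle) where
  carrier := {φ | (∀ x y, φ (x + y) = φ x + φ y) ∧ ∀ x ∈ F, φ x = 0}
  add_mem' := fun {φ ψ} hφ hψ =>
    ⟨fun x y => by simp only [Pi.add_apply, hφ.1, hψ.1]; abel,
      fun x hx => by simp [hφ.2 x hx, hψ.2 x hx]⟩
  zero_mem' := ⟨by simp, by simp⟩
  neg_mem' := fun {φ} hφ =>
    ⟨fun x y => by simp only [Pi.neg_apply, hφ.1]; abel, fun x hx => by simp [hφ.2 x hx]⟩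

/-- A member of `characterAnnihilator F` as a homomorphism. -/
def characterAnnihilator.toHom {A : Type*} [AddCommGroup A] {F : Set A}
    (φ : characterAnnihilator F) : A →+ UnitAddCircle :=
  AddMonoidHom.mk' φ.1 φ.2.1

instance {A : Type*} [AddCommGroup A] (F : Set A) : CompactSpace (characterAnnihilator F) := by
  refine isCompact_iff_compactSpace.1
    (IsClosed.isCompact (s := (characterAnnihilator F : Set (A → UnitAddCircle))) ?_)
  have : (characterAnnihilator F : Set (A → UnitAddCircle)) =
      (⋂ x, ⋂ y, {φ | φ (x + y) = φ x + φ y}) ∩ ⋂ x ∈ F, {φ | φ x = 0} := by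
    ext φ
    simp [characterAnnihilator]
  rw [this]
  refine IsClosed.inter (isClosed_iInter fun x => isClosed_iInter fun y => ?_)
    (isClosed_iInter fun x => isClosed_iInter fun _ => ?_)
  · exact isClosed_eq (by fun_prop) (by fun_prop)
  · exact isClosed_eq (continuous_apply _) continuous_const

/-- Whitehead groups of finite rank are finitely generated. -/
theorem CharactersLift.finite_of_rank_lt_aleph0 {A : Type*} [AddCommGroup A]
    (h : CharactersLift A) (hr : Module.rank ℤ A < ℵ₀) : Module.Finite ℤ A := by
  obtain ⟨s, hs, hmax⟩ := exists_maximal_linearIndepOn ℤ (id : A → A)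
  have hfin : s.Finite := by
    rw [← Cardinal.lt_aleph0_iff_set_finite]
    exact (LinearIndependent.cardinal_le_rank hs).trans_lt hr
  have htors (a : A) : ∃ n : ℤ, n ≠ 0 ∧ n • a ∈ Submodule.span ℤ s := by
    by_cases ha : a ∈ s
    · exact ⟨1, one_ne_zero, by simpa using Submodule.subset_span ha⟩
    · simpa using hmax a ha
  have : Finite s := hfin
  -- A real lift takes integer values on the finite set `s`, and these determine it because `A` is
  -- torsion modulo the span.
  have hcount : Countable (characterAnnihilator s) := by
    have hlift (φ : characterAnnihilator s) : ∃ (g : A →+ ℝ) (n : s → ℤ),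
        (∀ a, (g a : UnitAddCircle) = φ.1 a) ∧ ∀ x : s, g x = n x := by
      obtain ⟨g, hg⟩ := h (characterAnnihilator.toHom φ)
      have hint (x : s) : ∃ n : ℤ, (n : ℝ) = g x :=
        (coe_eq_zero_iff_exists_int _).1 ((hg x).trans (φ.2.2 x x.2))
      choose n hn using hint
      exact ⟨g, n, hg, fun x => (hn x).symm⟩
    choose g n hg hn using hlift
    refine Function.Injective.countable (f := n) fun φ ψ hφψ => ?_
    have heq : ∀ a ∈ Submodule.span ℤ s, g φ a = g ψ a := by
      have : Set.EqOn (g φ).toIntLinearMap (g ψ).toIntLinearMap s := fun x hx => by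
        change g φ x = g ψ x
        rw [hn φ ⟨x, hx⟩, hn ψ ⟨x, hx⟩, hφψ]
      exact LinearMap.eqOn_span this
    refine Subtype.ext (funext fun a => ?_)
    obtain ⟨m, hm, hma⟩ := htors a
    have := heq _ hma
    rw [map_zsmul, map_zsmul] at this
    rw [← hg, ← hg, smul_right_injective ℝ hm this]
  have := finite_of_countable_of_compact (characterAnnihilator s)
  -- The order `m` kills every character trivial on `s`, so `m • A` lies in the span of `s`.
  let m := Nat.card (characterAnnihilator s)
  have hm : (m : ℤ) ≠ 0 := by exact_mod_cast Nat.card_pos.ne'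
  have hmem (a : A) : (m : ℤ) • a ∈ Submodule.span ℤ s := by
    by_contra hna
    obtain ⟨χ, hχ, hχa⟩ := exists_character_ne_zero (Submodule.span ℤ s).toAddSubgroup hna
    apply hχa
    let φ : characterAnnihilator s :=
      ⟨χ, map_add χ, fun x hx => hχ x (Submodule.subset_span hx)⟩
    have hφ : m • φ = 0 := card_nsmul_eq_zero'
    have : m • χ a = 0 := congrFun (congrArg Subtype.val hφ) a
    rw [map_zsmul, natCast_zsmul, this]
  have : Module.Finite ℤ (Submodule.span ℤ s) := Module.Finite.span_of_finite ℤ hfin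
  let mul : A →ₗ[ℤ] Submodule.span ℤ s := (LinearMap.lsmul ℤ A (m : ℤ)).codRestrict _ hmem
  refine Module.Finite.of_injective mul ?_
  rw [injective_iff_map_eq_zero]
  intro a ha
  exact h.eq_zero_of_zsmul_eq_zero hm (congrArg Subtype.val ha)

/-! ### Divisible coresolutions and maps that do not extend -/

lemma injective_of_divisibleBy (D : Type u) [AddCommGroup D] [DivisibleBy D ℤ] :
    Injective (ModuleCat.of ℤ D) :=
  Module.injective_object_of_injective_module (inj := (Module.Baer.of_divisible D).injective)

/-- A subgroup of a divisible group is the kernel of a surjection of divisible groups. -/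
lemma exists_shortExact_of_divisibleBy {N : ModuleCat.{u} ℤ} {D : Type u} [AddCommGroup D]
    [DivisibleBy D ℤ] (φ : N →+ D) (hφ : Function.Injective φ) :
    ∃ S : ShortComplex (ModuleCat.{u} ℤ), S.ShortExact ∧ S.X₁ = N ∧
      Injective S.X₂ ∧ Injective S.X₃ := by
  have : DivisibleBy (D ⧸ φ.range) ℤ :=
    (QuotientAddGroup.mk_surjective (s := φ.range)).divisibleBy (QuotientAddGroup.mk' φ.range)
      fun a n => map_zsmul _ n a
  let S : ShortComplex (ModuleCat.{u} ℤ) :=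
    ShortComplex.mk (moduleHomOfAdd (Y := ModuleCat.of ℤ D) φ)
      (moduleHomOfAdd (X := ModuleCat.of ℤ D) (Y := ModuleCat.of ℤ (D ⧸ φ.range))
        (QuotientAddGroup.mk' φ.range))
      (ModuleCat.hom_ext (LinearMap.ext fun x => (QuotientAddGroup.eq_zero_iff _).2 ⟨x, rfl⟩))
  refine ⟨S, { exact := ?_, mono_f := ?_, epi_g := ?_ }, rfl, injective_of_divisibleBy D,
    injective_of_divisibleBy _⟩
  · rw [ShortComplex.moduleCat_exact_iff]
    exact fun x hx => (QuotientAddGroup.eq_zero_iff _).1 hx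
  · exact (ModuleCat.mono_iff_injective _).2 hφ
  · exact (ModuleCat.epi_iff_surjective _).2 (QuotientAddGroup.mk'_surjective _)

/-- Every abelian group is the kernel of a surjection of divisible groups. -/
lemma exists_injective_coresolution (N : ModuleCat.{u} ℤ) :
    ∃ S : ShortComplex (ModuleCat.{u} ℤ), S.ShortExact ∧ S.X₁ = N ∧
      Injective S.X₂ ∧ Injective S.X₃ := by
  let φ : N →+ (CharacterModule N → AddCircle (1 : ℚ)) :=
    AddMonoidHom.mk' (fun x c => c x) fun x y => funext fun c => map_add c x y
  refine exists_shortExact_of_divisibleBy φ ?_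
  rw [injective_iff_map_eq_zero]
  intro x hx
  by_contra hx0
  obtain ⟨c, hc⟩ := CharacterModule.exists_character_apply_ne_zero_of_ne_zero hx0
  exact hc (congrFun hx c)

/-- Subobjects of projective `ℤ`-modules are projective. -/
lemma projective_of_mono {K F : ModuleCat.{u} ℤ} (j : K ⟶ F) [Mono j] [Projective F] :
    Projective K := by
  rw [projective_iff_subsingleton_ext_one.{u}]
  intro N
  obtain ⟨S, hS, rfl, _, _⟩ := exists_injective_coresolution N
  rw [ext_subsingleton_iff_lifts hS]
  -- As `S.X₃` is injective, `f` extends to `F`; it then lifts to `S.X₂` by projectivity of `F`.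
  intro f
  have := hS.epi_g
  refine ⟨j ≫ Projective.factorThru (Injective.factorThru f j) S.g, ?_⟩
  rw [Category.assoc, Projective.factorThru_comp, Injective.comp_factorThru]

/-- A nonzero element of `Ext(H, A)` with `H` Whitehead is represented by a map `K ⟶ A` which does
not extend along some `K ⟶ F` having the lifting property against `ℝ → ℝ / ℤ`. -/
lemma exists_not_extends {H A : Type u} [AddCommGroup H] [AddCommGroup A] (hH : IsWhitehead H)
    (hHA : Nontrivial (ExtGroup H A)) :
    ∃ (K F : ModuleCat.{u} ℤ) (i : K ⟶ F) (k : K ⟶ ModuleCat.of ℤ A), Projective K ∧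
      HasLiftingProperty i realToCircle.{u} ∧ ¬ ∃ g : F ⟶ ModuleCat.of ℤ A, i ≫ g = k := by
  let q : (H →₀ ℤ) →ₗ[ℤ] H := Finsupp.linearCombination ℤ id
  let S : ShortComplex (ModuleCat.{u} ℤ) :=
    ShortComplex.mk (ModuleCat.ofHom (LinearMap.ker q).subtype) (ModuleCat.ofHom q) (by
      ext x; exact x.2)
  have hS : S.ShortExact :=
    { exact := by
        rw [ShortComplex.moduleCat_exact_iff]
        exact fun x hx => ⟨⟨x, hx⟩, rfl⟩
      mono_f := (ModuleCat.mono_iff_injective _).2 Subtype.val_injective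
      epi_g := (ModuleCat.epi_iff_surjective _).2 fun x =>
        ⟨Finsupp.single x 1, by simp [S, q]⟩ }
  have : Projective S.X₂ := ModuleCat.projective_of_free (M := ModuleCat.of ℤ (H →₀ ℤ))
    (Module.Free.chooseBasis ℤ (H →₀ ℤ))
  have := hS.mono_f
  have : Projective S.X₁ := projective_of_mono S.f
  have hk : ∃ k : S.X₁ ⟶ ModuleCat.of ℤ A, ¬ ∃ g : S.X₂ ⟶ ModuleCat.of ℤ A, S.f ≫ g = k := by
    by_contra! hall
    exact not_subsingleton_iff_nontrivial.2 hHA (ext_subsingleton_of_extends hS _ hall)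
  obtain ⟨k, hk⟩ := hk
  exact ⟨S.X₁, S.X₂, S.f, k, this,
    hasLiftingProperty_of_exact hS ((isWhitehead_iff_charactersLift H).1 hH), hk⟩

/-! ### The killing extension -/

lemma CharactersLift.aleph0_le_rank {A : Type*} [AddCommGroup A] (h : CharactersLift A)
    (hfg : ¬ AddGroup.FG A) : ℵ₀ ≤ Module.rank ℤ A := by
  by_contra! hr
  exact hfg (Module.Finite.iff_addGroup_fg.1 (h.finite_of_rank_lt_aleph0 hr))

/-- Every group `X` maps to a group `Y`, with the lifting property against `ℝ → ℝ / ℤ`, such that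
no homomorphism `X → B` whose range is not finitely generated extends to `Y` with the same range. -/
theorem exists_killing_extension
    (hExt : ∀ (A : Type u) [AddCommGroup A], IsWhitehead A → ℵ₀ ≤ Module.rank ℤ A →
      ∃ (H : Type u) (_ : AddCommGroup H), IsWhitehead H ∧ Nontrivial (ExtGroup H A))
    (B : Type u) [AddCommGroup B] (hB : IsWhitehead B) (X : ModuleCat.{u} ℤ) :
    ∃ (Y : ModuleCat.{u} ℤ) (i : X ⟶ Y), HasLiftingProperty i realToCircle.{u} ∧
      ∀ f : Y →+ B, (f.comp i.hom.toAddMonoidHom).range = f.range → f.range.FG := by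
  let I := {h : X →+ B // ¬ h.range.FG}
  have hdata (h : I) : ∃ (K F : ModuleCat.{u} ℤ) (i : K ⟶ F) (k : K ⟶ ModuleCat.of ℤ h.1.range),
      Projective K ∧ HasLiftingProperty i realToCircle.{u} ∧
        ¬ ∃ g : F ⟶ ModuleCat.of ℤ h.1.range, i ≫ g = k := by
    have hA : CharactersLift h.1.range := CharactersLift.of_injective h.1.range.subtype
      Subtype.val_injective ((isWhitehead_iff_charactersLift B).1 hB)
    obtain ⟨H, _, hH, hHA⟩ := hExt h.1.range ((isWhitehead_iff_charactersLift _).2 hA)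
      (hA.aleph0_le_rank fun hfg => h.2 ((AddGroup.fg_iff_addSubgroup_fg _).1 hfg))
    exact exists_not_extends hH hHA
  choose K F i k hK hi hk using hdata
  let r (h : I) : X ⟶ ModuleCat.of ℤ h.1.range :=
    moduleHomOfAdd (Y := ModuleCat.of ℤ h.1.range) h.1.rangeRestrict
  have hr (h : I) : Epi (r h) :=
    (ModuleCat.epi_iff_surjective _).2 h.1.rangeRestrict_surjective
  let l (h : I) : K h ⟶ X := Projective.factorThru (k h) (r h)
  have hl (h : I) : l h ≫ r h = k h := Projective.factorThru_comp (k h) (r h)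
  refine ⟨pushout (Sigma.desc l) (Limits.Sigma.map i), pushout.inl _ _, ?_, ?_⟩
  · exact (IsPushout.of_hasPushout (Sigma.desc l) (Limits.Sigma.map i)).hasLiftingProperty _
  · intro f hf
    by_contra hfg
    let h : I := ⟨f.comp (pushout.inl (Sigma.desc l) (Limits.Sigma.map i)).hom.toAddMonoidHom,
      by rwa [hf]⟩
    let f' : pushout (Sigma.desc l) (Limits.Sigma.map i) ⟶ ModuleCat.of ℤ h.1.range :=
      moduleHomOfAdd (Y := ModuleCat.of ℤ h.1.range) (f.codRestrict _ fun y => by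
        rw [hf]; exact ⟨y, rfl⟩)
    have hf' : pushout.inl _ _ ≫ f' = r h := rfl
    apply hk h
    -- On the summand `F h`, the map `f'` would extend `k h`.
    refine ⟨Sigma.ι F h ≫ pushout.inr (Sigma.desc l) (Limits.Sigma.map i) ≫ f', ?_⟩
    have := Sigma.ι K h ≫= pushout.condition (f := Sigma.desc l) (g := Limits.Sigma.map i) =≫ f'
    simp only [Category.assoc, hf'] at this
    simpa [hl] using this.symm

/-! ### Transfinite iteration -/

lemma charactersLift_finsupp (ι : Type*) : CharactersLift (ι →₀ ℤ) := by
  intro χ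
  choose r hr using fun i => QuotientAddGroup.mk_surjective (χ (Finsupp.single i 1))
  let g : (ι →₀ ℤ) →+ ℝ := (Finsupp.linearCombination ℤ r).toAddMonoidHom
  refine ⟨g, fun a => ?_⟩
  have : (QuotientAddGroup.mk' (AddSubgroup.zmultiples (1 : ℝ))).comp g = χ := by
    refine Finsupp.addHom_ext' fun i => AddMonoidHom.ext_int ?_
    simpa [g] using hr i
  exact DFunLike.congr_fun this a

/-- Integer-valued homomorphisms extend along maps with the lifting property against
`ℝ → ℝ / ℤ`, so such maps are injective on free groups. -/
lemma injective_of_hasLiftingProperty {ι : Type u} {Y : ModuleCat.{u} ℤ}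
    (i : ModuleCat.of ℤ (ι →₀ ℤ) ⟶ Y) (hi : HasLiftingProperty i realToCircle.{u}) :
    Function.Injective i := by
  rw [hasLiftingProperty_realToCircle_iff] at hi
  intro x y hxy
  refine Finsupp.ext fun a => ?_
  obtain ⟨g, hg, -⟩ := hi ((Int.castAddHom ℝ).comp (Finsupp.applyAddHom a)) 0 fun x =>
    (coe_eq_zero_iff_exists_int _).2 ⟨(x : ι →₀ ℤ) a, rfl⟩
  have : ((x : ι →₀ ℤ) a : ℝ) = ((y : ι →₀ ℤ) a : ℝ) :=
    (hg x).symm.trans ((congrArg g hxy).trans (hg y))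
  exact_mod_cast this

/-- The group is obtained by iterating the extensions of `exists_killing_extension` transfinitely,
the length being a regular cardinal above the cardinality of `B`. The bound on the cardinality of
`H` and the generalized continuum hypothesis are not needed. -/
theorem exists_whitehead_range_fg
    (hExt : ∀ (A : Type u) [AddCommGroup A], IsWhitehead A → ℵ₀ ≤ Module.rank ℤ A →
      ∃ (H : Type u) (_ : AddCommGroup H), IsWhitehead H ∧ Nontrivial (ExtGroup H A))
    (B : Type u) [AddCommGroup B] (hB : IsWhitehead B) :
    ∃ (G : Type u) (_ : AddCommGroup G),
      IsWhitehead G ∧ Uncountable G ∧ ∀ f : G →+ B, f.range.FG := by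
  choose Y i hi hY using exists_killing_extension hExt B hB
  let Φ : SmallObject.SuccStruct (ModuleCat.{u} ℤ) :=
    { X₀ := ModuleCat.of ℤ (ULift.{u} ℝ →₀ ℤ)
      succ := Y
      toSucc := i }
  -- Regularity and `#B < κ` ensure that one stage bounds chosen preimages of all elements of the
  -- range.
  let κ : Cardinal.{u} := Order.succ (max ℵ₀ #B)
  have hκ : κ.IsRegular := isRegular_succ (le_max_left _ _)
  have : Fact κ.IsRegular := ⟨hκ⟩
  let J := κ.ord.ToType
  have : Nonempty J := Ordinal.nonempty_toType_iff.2 (by simpa using hκ.pos.ne')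
  let _ : OrderBot J := WellFoundedLT.toOrderBot J
  have hmax : NoMaxOrder J := Cardinal.noMaxOrder hκ.aleph0_le
  have : IsFiltered J := isFiltered_of_isCardinalFiltered J κ
  let T : MorphismProperty (ModuleCat.{u} ℤ) := .ofHoms fun _ : Unit => realToCircle.{u}
  have hT {X Y : ModuleCat.{u} ℤ} (j : X ⟶ Y) : T.llp j ↔ HasLiftingProperty j realToCircle.{u} :=
    MorphismProperty.llp_ofHoms_iff_hasLiftingProperty Unit j realToCircle
  have hle : Φ.prop ≤ T.llp := by
    rintro _ _ _ ⟨_⟩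
    exact (hT _).2 (hi _)
  have hmem : HasLiftingProperty (Φ.ιIteration J) realToCircle.{u} :=
    (hT _).1 (T.llp.transfiniteCompositionsOfShape_le J _
      ((Φ.transfiniteCompositionOfShapeιIteration J).ofLE hle).mem)
  refine ⟨Φ.iteration J, inferInstance, ?_, ?_, fun f => ?_⟩
  · rw [isWhitehead_iff_charactersLift]
    exact .of_hasLiftingProperty _ hmem (charactersLift_finsupp _)
  · have h₀ : Uncountable (ULift.{u} ℝ →₀ ℤ) :=
      (Finsupp.single_left_injective (one_ne_zero (α := ℤ))).uncountable
    exact (injective_of_hasLiftingProperty _ hmem).uncountable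
  · let F := Φ.iterationFunctor J
    let c := Φ.iterationCocone J
    have : PreservesColimitsOfShape J (forget (ModuleCat.{u} ℤ)) :=
      inferInstanceAs (PreservesColimitsOfShape J
        (forget₂ (ModuleCat.{u} ℤ) AddCommGrpCat.{u} ⋙ forget AddCommGrpCat.{u}))
    have hrep (b : f.range) : ∃ (j : J) (x : F.obj j), f (c.ι.app j x) = b := by
      obtain ⟨_, y, rfl⟩ := b
      obtain ⟨j, x, rfl⟩ := Concrete.isColimit_exists_rep F (Φ.isColimitIterationCocone J) y
      exact ⟨j, x, rfl⟩
    choose j x hx using hrep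
    have hcard : HasCardinalLT f.range κ := by
      rw [hasCardinalLT_iff_cardinal_mk_lt]
      exact Order.lt_succ_of_le ((mk_set_le _).trans (le_max_right _ _))
    let m : J := IsCardinalFiltered.max j hcard
    let e := Φ.iterationFunctorObjSuccIso m (not_isMax m)
    let f' : Y (F.obj m) →+ B := f.comp (e.inv ≫ c.ι.app (Order.succ m)).hom.toAddMonoidHom
    have hf' : f'.comp (i (F.obj m)).hom.toAddMonoidHom =
        f.comp (c.ι.app m).hom.toAddMonoidHom := by
      have : i (F.obj m) ≫ e.inv ≫ c.ι.app (Order.succ m) = c.ι.app m := by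
        rw [← c.w (homOfLE (Order.le_succ m)), Φ.iterationFunctor_map_succ m (not_isMax m)]
        simp [Φ, e, F]
      ext z
      exact congrArg (fun φ => f (φ.hom z)) this
    have hge : f.range ≤ (f.comp (c.ι.app m).hom.toAddMonoidHom).range := by
      intro b hb
      refine ⟨F.map (IsCardinalFiltered.toMax j hcard ⟨b, hb⟩) (x ⟨b, hb⟩), ?_⟩
      refine Eq.trans ?_ (hx ⟨b, hb⟩)
      exact congrArg (fun φ => f (φ.hom (x ⟨b, hb⟩)))
        (c.w (IsCardinalFiltered.toMax j hcard ⟨b, hb⟩))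
    have hle' : f'.range ≤ f.range := by
      rintro _ ⟨z, rfl⟩
      exact ⟨_, rfl⟩
    have hcomp : (f'.comp (i (F.obj m)).hom.toAddMonoidHom).range ≤ f'.range := by
      rintro _ ⟨z, rfl⟩
      exact ⟨_, rfl⟩
    have heq : f'.range = f.range :=
      le_antisymm hle' (hge.trans (hf' ▸ hcomp))
    -- Stages `m` and `m + 1` have the same image under `f`, so `hY` applies.
    rw [← heq]
    refine hY (F.obj m) f' (le_antisymm hcomp ?_)
    rw [hf', heq]
    exact hge

theorem mainTheorem5
    (gch : GCH.{u})
    (hExt : ∀ (A : Type u) [AddCommGroup A], IsWhitehead A → ℵ₀ ≤ Module.rank ℤ A →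
      ∃ (H : Type u) (_ : AddCommGroup H),
        IsWhitehead H ∧ #H ≤ Order.succ #A ∧ Nontrivial (ExtGroup H A))
    (B : Type u) [AddCommGroup B] (hB : IsWhitehead B) :
    ∃ (G : Type u) (_ : AddCommGroup G),
      IsWhitehead G ∧ Uncountable G ∧ ∀ f : G →+ B, f.range.FG := by
  refine exists_whitehead_range_fg (fun A _ hA hr => ?_) B hB
  obtain ⟨H, _, hH, -, hHA⟩ := hExt A hA hr
  exact ⟨H, _, hH, hHA⟩
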